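/- For $r\ge 2$, an $r$-graph is a finite $r$-uniform hypergraph, and $\mathrm{ex}(n,H)$ denotes the largest number of edges in an $r$-graph on $n$ vertices which contains no subgraph (not necessarily induced) isomorphic to the $r$-graph $H$. Let $\pi(H)=\lim_{n\to\infty}\mathrm{ex}(n,H)/\binom{n}{r}$ be the Turán density of $H$, and let $H_3^r$ be the (unique up to isomorphism) $r$-graph with $r+1$ vertices and $3$ edges. For real $x>0$ put $$F(x)=\frac{2xe^{-x}}{1-e^{-2x}}+2x\sum_{i=1}^{\infty}2^{-i}\exp(-2^{-i}x)-4x^2\sum_{i=1}^{\infty}2^{-2i}\exp(-2^{1-i}x),$$ where both series converge. Then: 1. For every $r\ge 2$ the limit defining $\pi(H_3^r)$ exists. 2. For all real $x>0$ and $\varepsilon>0$, $$\pi(H_3^r)\ \ge\ \frac{F(x)-\varepsilon-o(1)}{r^2}\qquad\text{as } r\to\infty,$$ where the $o(1)$ term may depend on $x$ and $\varepsilon$. 3. $F(1.065)>1.7215$. 4. $\pi(H_3^r)\ \ge\ (1.7215-o(1))\,r^{-2}$ as $r\to\infty$. -/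

import Mathlib

open Filter Topology

/-- A (finite) `r`-uniform hypergraph, for short `r`-graph, with vertex set the whole type `V`. -/
structure RGraph (V : Type*) (r : ℕ) where
  /-- The set of edges. -/
  edges : Finset (Finset V)
  /-- Every edge has exactly `r` vertices. -/
  card_eq : ∀ e ∈ edges, e.card = r

namespace RGraph

/-- `G` contains a (not necessarily induced) subgraph isomorphic to `H`: there is an injection of
the vertices of `H` into those of `G` that maps every edge of `H` to an edge of `G`. -/
def Contains {V W : Type*} {r : ℕ} (G : RGraph V r) (H : RGraph W r) : Prop :=
  ∃ f : W ↪ V, ∀ e ∈ H.edges, e.map f ∈ G.edges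

/-- The Turán number `ex(n, H)`: the largest number of edges of an `H`-free `r`-graph with `n`
vertices. -/
noncomputable def turanNumber {W : Type*} {r : ℕ} (n : ℕ) (H : RGraph W r) : ℕ :=
  sSup {m : ℕ | ∃ G : RGraph (Fin n) r, ¬ G.Contains H ∧ G.edges.card = m}

/-- The Turán density `π(H) = lim_{n → ∞} ex(n, H) / (n choose r)`. -/
noncomputable def turanDensity {W : Type*} {r : ℕ} (H : RGraph W r) : ℝ :=
  limUnder atTop (fun n : ℕ => (turanNumber n H : ℝ) / (n.choose r : ℝ))

/-- The `r`-graph `H_k^r` with `r + 1` vertices and `k ≤ r + 1` edges (unique up to isomorphism):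
every `r`-subset of the `r + 1` vertices is the complement of one vertex, and the edges of this
representative are the complements of the vertices `0, …, k - 1`. -/
def daisy (k r : ℕ) : RGraph (Fin (r + 1)) r where
  edges := (Finset.univ.filter (fun i : Fin (r + 1) => i.val < k)).image
    (fun i => Finset.univ.erase i)
  card_eq := by
    intro e he
    obtain ⟨i, -, rfl⟩ := Finset.mem_image.mp he
    simp

/-- `H_k^r` has exactly `k` edges. -/
theorem card_edges_daisy {k r : ℕ} (h : k ≤ r + 1) : (daisy k r).edges.card = k := by
  have hinj : Set.InjOn (fun i : Fin (r + 1) => Finset.univ.erase i)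
      (Finset.univ.filter (fun i : Fin (r + 1) => i.val < k) : Finset (Fin (r + 1))) := by
    intro i _ j _ hij
    by_contra hne
    have : i ∈ Finset.univ.erase j := by simp [hne]
    simp only at hij
    rw [← hij] at this
    simp at this
  rw [daisy, Finset.card_image_of_injOn hinj, Fin.card_filter_val_lt, min_eq_right h]

end RGraph

/-- The function
`F(x) = 2x e^{-x} / (1 - e^{-2x}) + 2x ∑_{i ≥ 1} 2^{-i} exp(-2^{-i} x)
  - 4x² ∑_{i ≥ 1} 2^{-2i} exp(-2^{1-i} x)`;
both series are indexed below by `j = i - 1 ≥ 0`. -/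
noncomputable def turanSeriesF (x : ℝ) : ℝ :=
  2 * x * Real.exp (-x) / (1 - Real.exp (-2 * x))
    + 2 * x * (∑' j : ℕ, (1 / 2 : ℝ) ^ (j + 1) * Real.exp (-((1 / 2 : ℝ) ^ (j + 1) * x)))
    - 4 * x ^ 2 * (∑' j : ℕ, (1 / 2 : ℝ) ^ (2 * (j + 1)) * Real.exp (-((1 / 2 : ℝ) ^ j * x)))

/-- The first series in the definition of `F` converges for `x ≥ 0`. -/
theorem summable_turanSeriesF_first {x : ℝ} (hx : 0 ≤ x) :
    Summable (fun j : ℕ => (1 / 2 : ℝ) ^ (j + 1) * Real.exp (-((1 / 2 : ℝ) ^ (j + 1) * x))) := by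
  refine Summable.of_nonneg_of_le (fun j => by positivity) (fun j => ?_)
    ((summable_nat_add_iff 1).mpr summable_geometric_two)
  refine mul_le_of_le_one_right (by positivity) (Real.exp_le_one_iff.mpr ?_)
  have : 0 ≤ (1 / 2 : ℝ) ^ (j + 1) * x := by positivity
  linarith

/-- The second series in the definition of `F` converges for `x ≥ 0`. -/
theorem summable_turanSeriesF_second {x : ℝ} (hx : 0 ≤ x) :
    Summable (fun j : ℕ => (1 / 2 : ℝ) ^ (2 * (j + 1)) * Real.exp (-((1 / 2 : ℝ) ^ j * x))) := by
  refine Summable.of_nonneg_of_le (fun j => by positivity) (fun j => ?_) summable_geometric_two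
  have h0 : 0 ≤ (1 / 2 : ℝ) ^ j * x := by positivity
  refine (mul_le_of_le_one_right (by positivity) (Real.exp_le_one_iff.mpr (by linarith))).trans ?_
  exact pow_le_pow_of_le_one (by norm_num) (by norm_num) (by omega)

/-! ### Existence of the Turán density by averaging over vertex deletions. -/

namespace RGraph

/-! The limit exists by the usual averaging argument. For the lower bound, give every vertex a
random weight in `ZMod m × (ZMod 2)^L` and decide whether an `r`-set is an edge from its shifted
total weight `g`. Either `g` has first coordinate `k` with `1 ≤ k ≤ K`, and the first coordinates of
the weights in the set are pairwise at distance at least `k`; or `g` lies in layer `i` of a chain of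
subgroups with successive index two, the weights are distinct modulo the next subgroup, and no level
`j ≤ i` has a unique colliding pair.

If `S` has `r + 1` vertices and total `σ`, then `S \ {u}` has total `σ - w u`, so differences of
edge totals are differences of vertex weights. Given three edges inside `S`, order them by class.
The separation demanded by the highest class forbids the difference produced by the two lower ones,
except when the two higher classes agree and the lowest is a strictly deeper layer; there the
excluded unique collision appears (`exists_oneCollision`, `not_inClass_of_le`).

The expected density is a sum of birthday-type probabilities, bounded through
`exp_le_proportion_separated` and `proportion_oneCollision_le`. With `m` about `r ^ 2 / (2 * x)`, so
that `r ^ 2 / m → 2 * x`, the strips yield the geometric series in `F`, the layers its first series,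
and the excluded collisions the subtracted one. The value at `1.065` comes from finite sums with
explicit tails. -/

theorem bddAbove_card_edges {W : Type*} {r : ℕ} (n : ℕ) (H : RGraph W r) :
    BddAbove {m : ℕ | ∃ G : RGraph (Fin n) r, ¬ G.Contains H ∧ G.edges.card = m} := by
  refine ⟨Fintype.card (Finset (Fin n)), ?_⟩
  rintro m ⟨G, -, rfl⟩
  exact Finset.card_le_univ _

theorem card_edges_le_turanNumber {W : Type*} {r n : ℕ} {H : RGraph W r} {G : RGraph (Fin n) r}
    (hG : ¬ G.Contains H) : G.edges.card ≤ turanNumber n H :=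
  le_csSup (bddAbove_card_edges n H) ⟨G, hG, rfl⟩

theorem exists_card_edges_eq_turanNumber {W : Type*} {r : ℕ} (n : ℕ) {H : RGraph W r}
    (hH : H.edges.Nonempty) :
    ∃ G : RGraph (Fin n) r, ¬ G.Contains H ∧ G.edges.card = turanNumber n H := by
  refine Nat.sSup_mem (s := {m : ℕ | ∃ G : RGraph (Fin n) r, ¬ G.Contains H ∧ G.edges.card = m})
    ⟨0, ⟨∅, by simp⟩, ?_, by simp⟩ (bddAbove_card_edges n H)
  rintro ⟨f, hf⟩
  obtain ⟨e, he⟩ := hH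
  simpa using hf e he

/-- The `r`-graph on `Fin n` obtained by deleting the vertex `i`. -/
noncomputable def deleteVertex {n r : ℕ} (G : RGraph (Fin (n + 1)) r) (i : Fin (n + 1)) :
    RGraph (Fin n) r where
  edges := Finset.univ.filter (fun e => e.map i.succAboveEmb ∈ G.edges)
  card_eq := by
    intro e he
    have := G.card_eq _ (Finset.mem_filter.mp he).2
    simpa using this

theorem not_contains_deleteVertex {W : Type*} {n r : ℕ} {G : RGraph (Fin (n + 1)) r}
    {H : RGraph W r} (hG : ¬ G.Contains H) (i : Fin (n + 1)) :
    ¬ (G.deleteVertex i).Contains H := by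
  rintro ⟨f, hf⟩
  refine hG ⟨f.trans i.succAboveEmb, fun e he => ?_⟩
  have := (Finset.mem_filter.mp (hf e he)).2
  rwa [Finset.map_map] at this

theorem card_edges_deleteVertex {n r : ℕ} (G : RGraph (Fin (n + 1)) r) (i : Fin (n + 1)) :
    (G.deleteVertex i).edges.card = (G.edges.filter (fun e => i ∉ e)).card := by
  rw [← Finset.card_map (f := (Finset.mapEmbedding i.succAboveEmb).toEmbedding)]
  congr 1
  ext e
  simp only [deleteVertex, Finset.mem_map, Finset.mem_filter, Finset.mem_univ, true_and,
    RelEmbedding.coe_toEmbedding, Finset.mapEmbedding_apply]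
  constructor
  · rintro ⟨e', h, rfl⟩
    exact ⟨h, by simp [Fin.succAbove_ne]⟩
  · rintro ⟨h, hi⟩
    have : (Finset.univ.filter (fun j : Fin n => i.succAbove j ∈ e)).map
        i.succAboveEmb = e := by
      ext j
      simp only [Finset.mem_map, Finset.mem_filter, Finset.mem_univ, true_and]
      constructor
      · rintro ⟨k, hk, rfl⟩
        exact hk
      · intro hj
        obtain ⟨k, rfl⟩ := Fin.exists_succAbove_eq (x := j) (y := i) (by rintro rfl; exact hi hj)
        exact ⟨k, hj, rfl⟩
    exact ⟨_, by rwa [this], this⟩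

theorem sum_card_edges_deleteVertex {n r : ℕ} (G : RGraph (Fin (n + 1)) r) :
    ∑ i, (G.deleteVertex i).edges.card = (n + 1 - r) * G.edges.card := by
  simp_rw [card_edges_deleteVertex, Finset.card_filter]
  rw [Finset.sum_comm, Finset.sum_congr rfl (g := fun _ => n + 1 - r), Finset.sum_const,
    smul_eq_mul, mul_comm]
  intro e he
  rw [← Finset.card_filter]
  have : (Finset.univ.filter (fun i => i ∉ e)) = eᶜ := by ext; simp
  rw [this, Finset.card_compl, G.card_eq e he, Fintype.card_fin]

/-- Each edge of an extremal graph survives the deletion of exactly `n + 1 - r` vertices, and every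
deletion leaves an `H`-free graph. -/
theorem turanNumber_succ_le {W : Type*} {r : ℕ} (n : ℕ) {H : RGraph W r}
    (hH : H.edges.Nonempty) :
    (n + 1 - r) * turanNumber (n + 1) H ≤ (n + 1) * turanNumber n H := by
  obtain ⟨G, hG, hc⟩ := exists_card_edges_eq_turanNumber (n + 1) hH
  rw [← hc, ← sum_card_edges_deleteVertex]
  calc _ ≤ ∑ _i : Fin (n + 1), turanNumber n H :=
        Finset.sum_le_sum fun i _ => card_edges_le_turanNumber (not_contains_deleteVertex hG i)
    _ = _ := by simp

theorem turanNumber_div_choose_succ_le {W : Type*} {r n : ℕ} (hn : r ≤ n) {H : RGraph W r}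
    (hH : H.edges.Nonempty) :
    (turanNumber (n + 1) H : ℝ) / ((n + 1).choose r : ℝ)
      ≤ (turanNumber n H : ℝ) / (n.choose r : ℝ) := by
  have h1 : (0 : ℝ) < ((n + 1).choose r : ℝ) := by
    exact_mod_cast Nat.choose_pos (by omega)
  have h2 : (0 : ℝ) < (n.choose r : ℝ) := by exact_mod_cast Nat.choose_pos hn
  rw [div_le_div_iff₀ h1 h2]
  have h3 : (n.choose r) * (n + 1) = (n + 1).choose r * (n + 1 - r) :=
    Nat.choose_mul_succ_eq n r
  have h4 := turanNumber_succ_le n hH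
  have h5 : 0 < n + 1 - r := by omega
  have : (n + 1 - r) * (turanNumber (n + 1) H * n.choose r)
      ≤ (n + 1 - r) * (turanNumber n H * (n + 1).choose r) := by
    calc _ = ((n + 1 - r) * turanNumber (n + 1) H) * n.choose r := by ring
      _ ≤ ((n + 1) * turanNumber n H) * n.choose r := Nat.mul_le_mul_right _ h4
      _ = turanNumber n H * (n.choose r * (n + 1)) := by ring
      _ = _ := by rw [h3]; ring
  exact_mod_cast Nat.le_of_mul_le_mul_left this h5

theorem tendsto_turanDensity {W : Type*} {r : ℕ} {H : RGraph W r} (hH : H.edges.Nonempty) :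
    Tendsto (fun n : ℕ => (turanNumber n H : ℝ) / (n.choose r : ℝ)) atTop
      (𝓝 (turanDensity H)) := by
  refine tendsto_nhds_limUnder ?_
  -- The shift by `r` matters: below `r` the binomial vanishes and the quotient takes the default
  -- value 0, which would break monotonicity.
  have hanti : Antitone (fun n : ℕ => (turanNumber (n + r) H : ℝ) / ((n + r).choose r : ℝ)) := by
    refine antitone_nat_of_succ_le fun n => ?_
    rw [Nat.add_right_comm]
    exact turanNumber_div_choose_succ_le (Nat.le_add_left r n) hH
  have hbdd : BddBelow (Set.range
      (fun n : ℕ => (turanNumber (n + r) H : ℝ) / ((n + r).choose r : ℝ))) :=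
    ⟨0, by rintro _ ⟨n, rfl⟩; positivity⟩
  exact ⟨_, (tendsto_add_atTop_iff_nat r).mp (tendsto_atTop_ciInf hanti hbdd)⟩

theorem le_turanDensity {W : Type*} {r : ℕ} {H : RGraph W r} (hH : H.edges.Nonempty) {d : ℝ}
    (hd : ∀ n : ℕ, d * (n.choose r : ℝ) ≤ turanNumber n H) : d ≤ turanDensity H := by
  refine ge_of_tendsto (tendsto_turanDensity hH) ?_
  filter_upwards [eventually_ge_atTop r] with n hn
  rw [le_div_iff₀ (by exact_mod_cast Nat.choose_pos hn)]
  exact hd n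

theorem daisy_edges_nonempty (k r : ℕ) : (daisy (k + 1) r).edges.Nonempty :=
  ⟨_, Finset.mem_image.mpr ⟨0, by simp, rfl⟩⟩

theorem erase_mem_of_daisy {V : Type*} [DecidableEq V] {k r : ℕ} {G : RGraph V r}
    {f : Fin (r + 1) ↪ V} (hf : ∀ e ∈ (daisy k r).edges, e.map f ∈ G.edges)
    {i : Fin (r + 1)} (hi : i.val < k) : (Finset.univ.map f).erase (f i) ∈ G.edges := by
  rw [← Finset.map_erase]
  exact hf _ (Finset.mem_image.mpr ⟨i, by simpa using hi, rfl⟩)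

end RGraph

/-! ### The weight group, its chain of subgroups and its strips. -/

/-- The group `ZMod m × (ZMod 2)^L` of vertex weights. -/
abbrev WeightGroup (m L : ℕ) : Type := ZMod m × (Fin L → ZMod 2)

namespace WeightGroup

variable {m L : ℕ}

/-- The `i`-th subgroup of a chain of subgroups of the weight group, of index `m * 2 ^ i`. -/
def chain (m L i : ℕ) : AddSubgroup (WeightGroup m L) where
  carrier := {g | g.1 = 0 ∧ ∀ l : Fin L, l.val < i → g.2 l = 0}
  zero_mem' := by simp
  add_mem' := by
    rintro a b ⟨ha, ha'⟩ ⟨hb, hb'⟩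
    exact ⟨by simp [ha, hb], fun l hl => by simp [ha' l hl, hb' l hl]⟩
  neg_mem' := by
    rintro a ⟨ha, ha'⟩
    exact ⟨by simp [ha], fun l hl => by simp [ha' l hl]⟩

theorem chain_anti {i j : ℕ} (h : i ≤ j) : chain m L j ≤ chain m L i :=
  fun _ hg => ⟨hg.1, fun l hl => hg.2 l (hl.trans_le h)⟩

/-- Consecutive members of the chain have relative index at most two. -/
theorem sub_mem_chain_succ {i : ℕ} {g h : WeightGroup m L} (hg : g ∈ chain m L i)
    (hg' : g ∉ chain m L (i + 1)) (hh : h ∈ chain m L i) (hh' : h ∉ chain m L (i + 1)) :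
    g - h ∈ chain m L (i + 1) := by
  have key : ∀ g : WeightGroup m L, g ∈ chain m L i → g ∉ chain m L (i + 1) →
      ∀ l : Fin L, l.val = i → g.2 l = 1 := by
    intro g hg hg' l hl
    by_contra h1
    refine hg' ⟨hg.1, fun l' hl' => ?_⟩
    rcases Nat.lt_succ_iff_lt_or_eq.mp hl' with h | h
    · exact hg.2 l' h
    · have : l' = l := Fin.ext (h.trans hl.symm)
      subst this
      generalize g.2 l' = z at h1
      revert z
      decide
  refine ⟨by simp [hg.1, hh.1], fun l hl => ?_⟩
  rcases Nat.lt_succ_iff_lt_or_eq.mp hl with hli | hli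
  · simp [hg.2 l hli, hh.2 l hli]
  · simp [key g hg hg' l hli, key h hh hh' l hli]

/-- The elements whose first coordinate is the residue of an integer of absolute value below `k`. -/
def strip (m L k : ℕ) : Set (WeightGroup m L) := {g | ∃ j : ℤ, |j| < k ∧ g.1 = (j : ZMod m)}

theorem chain_zero_subset_strip {k : ℕ} (hk : 1 ≤ k) :
    (chain m L 0 : Set (WeightGroup m L)) ⊆ strip m L k :=
  fun g hg => ⟨0, by simp; omega, by simpa using hg.1⟩

end WeightGroup

open WeightGroup

/-! ### The edge rule, and why three edges never fit in `r + 1` vertices. -/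

section Good

variable {V A : Type*} [AddCommGroup A]

/-- No two distinct elements of `s` have weights that differ by an element of `N`. -/
def Separated (N : Set A) (w : V → A) (s : Finset V) : Prop :=
  ∀ a ∈ s, ∀ b ∈ s, a ≠ b → w a - w b ∉ N

theorem Separated.mono {N N' : Set A} {w : V → A} {s s' : Finset V} (h : Separated N w s)
    (hN : N' ⊆ N) (hs : s' ⊆ s) : Separated N' w s' :=
  fun a ha b hb hab hm => h a (hs ha) b (hs hb) hab (hN hm)

variable [DecidableEq V] {m L : ℕ}

/-- Modulo the `j`-th subgroup of the chain, the set `s` has exactly one pair of vertices of equal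
weight, and this pair is separated by the next subgroup. -/
def OneCollision (w : V → WeightGroup m L) (s : Finset V) (j : ℕ) : Prop :=
  ∃ a ∈ s, ∃ b ∈ s, a ≠ b ∧ w a - w b ∈ chain m L j ∧ w a - w b ∉ chain m L (j + 1) ∧
    Separated (chain m L j : Set (WeightGroup m L)) w (s.erase b)

/-- The condition under which a vertex set `s` of (shifted) total weight `g` is an edge. -/
def IsGood (K : ℕ) (w : V → WeightGroup m L) (s : Finset V) (g : WeightGroup m L) : Prop :=
  (∃ k : ℕ, 1 ≤ k ∧ k ≤ K ∧ g.1 = (k : ZMod m) ∧ Separated (strip m L k) w s) ∨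
  (∃ i < L, g ∈ chain m L i ∧ g ∉ chain m L (i + 1) ∧
    Separated (chain m L (i + 1) : Set (WeightGroup m L)) w s ∧ ∀ j ≤ i, ¬ OneCollision w s j)

/-- Two members `S \ {v}` and `S \ {w}` of a class that separates its own differences force a
single collision in every third member `S \ {u}` of a lower class. -/
theorem exists_oneCollision {w : V → WeightGroup m L} {S : Finset V} {a b u : V}
    (ha : a ∈ S) (hb : b ∈ S) (hab : a ≠ b) (hau : a ≠ u) (hbu : b ≠ u) {c i : ℕ}
    (hc : w a - w b ∈ chain m L c)
    (hsep : Separated (chain m L c : Set (WeightGroup m L)) w (S.erase b))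
    (hu : Separated (chain m L i : Set (WeightGroup m L)) w (S.erase u)) :
    ∃ j < i, OneCollision w (S.erase u) j := by
  have hi : w a - w b ∉ chain m L i :=
    hu a (Finset.mem_erase.mpr ⟨hau, ha⟩) b (Finset.mem_erase.mpr ⟨hbu, hb⟩) hab
  have hex : ∃ j, w a - w b ∉ chain m L j := ⟨i, hi⟩
  classical
  -- The level sought is the last one whose subgroup still contains `w a - w b`. It is at least `c`,
  -- so separation modulo level `c` passes down to it.
  have hlt : c < Nat.find hex := by
    rw [Nat.lt_find_iff]
    exact fun n hn => not_not.mpr (chain_anti hn hc)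
  obtain ⟨j, hj⟩ : ∃ j, Nat.find hex = j + 1 := ⟨Nat.find hex - 1, by omega⟩
  have hj1 : w a - w b ∉ chain m L (j + 1) := hj ▸ Nat.find_spec hex
  have hj0 : w a - w b ∈ chain m L j := by
    by_contra h
    have := Nat.find_min' hex h
    omega
  have hji : j < i := by
    have := Nat.find_min' hex hi
    omega
  refine ⟨j, hji, a, Finset.mem_erase.mpr ⟨hau, ha⟩, b, Finset.mem_erase.mpr ⟨hbu, hb⟩, hab, hj0,
    hj1, hsep.mono (chain_anti (by omega)) ?_⟩
  exact Finset.erase_subset_erase _ (Finset.erase_subset _ _)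

/-- The classes of weights, listed in increasing order. -/
def InClass (w : V → WeightGroup m L) (s : Finset V) (g : WeightGroup m L) (p : ℤ) :
    Prop :=
  (∃ k : ℕ, 1 ≤ k ∧ p = k ∧ g.1 = (k : ZMod m) ∧ Separated (strip m L k) w s) ∨
  (∃ i < L, p = -(i : ℤ) ∧ g ∈ chain m L i ∧ g ∉ chain m L (i + 1) ∧
    Separated (chain m L (i + 1) : Set (WeightGroup m L)) w s ∧ ∀ j ≤ i, ¬ OneCollision w s j)

theorem IsGood.inClass {K : ℕ} {w : V → WeightGroup m L} {s : Finset V} {g : WeightGroup m L}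
    (h : IsGood K w s g) : ∃ p, InClass w s g p := by
  rcases h with ⟨k, h1, -, h2, h3⟩ | ⟨i, h1, h2⟩
  · exact ⟨k, Or.inl ⟨k, h1, rfl, h2, h3⟩⟩
  · exact ⟨-i, Or.inr ⟨i, h1, rfl, h2⟩⟩

/-- Since `w u - w v = (σ - w v) - (σ - w u)`, the two lower classes determine a set containing this
difference, while `u` and `v` both lie in the third edge `S \ {z}`, whose separation set is the
largest. -/
theorem not_inClass_of_le {w : V → WeightGroup m L} {S : Finset V} {u v z : V}
    (hu : u ∈ S) (hv : v ∈ S) (hz : z ∈ S) (huv : u ≠ v) (huz : u ≠ z) (hvz : v ≠ z)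
    {σ : WeightGroup m L} {p q t : ℤ} (hpq : p ≤ q) (hqt : q ≤ t)
    (h1 : InClass w (S.erase u) (σ - w u) p) (h2 : InClass w (S.erase v) (σ - w v) q)
    (h3 : InClass w (S.erase z) (σ - w z) t) : False := by
  have huS : u ∈ S.erase z := Finset.mem_erase.mpr ⟨huz, hu⟩
  have hvS : v ∈ S.erase z := Finset.mem_erase.mpr ⟨hvz, hv⟩
  rcases h3 with ⟨k3, hk3, rfl, hg3, hs3⟩ | ⟨i3, hi3, rfl, hg3, hg3', hs3, hb3⟩
  · have hne := hs3 u huS v hvS huv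
    rcases h2 with ⟨k2, hk2, rfl, hg2, hs2⟩ | ⟨i2, hi2, rfl, hg2, hg2', hs2, hb2⟩
    · rcases h1 with ⟨k1, hk1, rfl, hg1, hs1⟩ | ⟨i1, hi1, rfl, hg1, hg1', hs1, hb1⟩
      -- Here `1 ≤ k1 ≤ k2 ≤ k3`, so the difference is below `k3`; starting the classes at 1 is
      -- essential.
      · refine hne ⟨(k2 : ℤ) - k1, by rw [abs_lt]; omega, ?_⟩
        have : (w u - w v).1 = (σ - w v).1 - (σ - w u).1 := by simp
        rw [this, hg1, hg2]; push_cast; rfl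
      · by_cases h23 : k2 = k3
        -- Equal residues only give a difference of size `k2`, which the strip of width `k3 = k2`
        -- just misses. Instead `v` and `z` collide modulo level 0, which is the unique collision
        -- that the lowest edge must not have.
        · subst h23
          have hc : w v - w z ∈ chain m L 0 := by
            refine ⟨?_, fun l hl => absurd hl (Nat.not_lt_zero _)⟩
            have : (w v - w z).1 = (σ - w z).1 - (σ - w v).1 := by simp
            rw [this, hg2, hg3, sub_self]
          obtain ⟨j, hj, hj'⟩ := exists_oneCollision (w := w) hv hz hvz huv.symm huz.symm
            (i := i1 + 1) hc (hs3.mono (chain_zero_subset_strip hk3) le_rfl) hs1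
          exact hb1 j (by omega) hj'
        · refine hne ⟨(k2 : ℤ), by rw [abs_lt]; omega, ?_⟩
          have : (w u - w v).1 = (σ - w v).1 - (σ - w u).1 := by simp
          rw [this, hg1.1, hg2]; push_cast; simp
    · rcases h1 with ⟨k1, hk1, rfl, hg1, hs1⟩ | ⟨i1, hi1, rfl, hg1, hg1', hs1, hb1⟩
      · omega
      · refine hne (chain_zero_subset_strip hk3 ⟨?_, fun l hl => absurd hl (Nat.not_lt_zero _)⟩)
        have : (w u - w v).1 = (σ - w v).1 - (σ - w u).1 := by simp
        rw [this, hg1.1, hg2.1, sub_self]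
  · have hne := hs3 u huS v hvS huv
    rcases h2 with ⟨k2, hk2, rfl, hg2, hs2⟩ | ⟨i2, hi2, rfl, hg2, hg2', hs2, hb2⟩
    · omega
    rcases h1 with ⟨k1, hk1, rfl, hg1, hs1⟩ | ⟨i1, hi1, rfl, hg1, hg1', hs1, hb1⟩
    · omega
    have huv' : w u - w v = (σ - w v) - (σ - w u) := by abel
    have hvz' : w v - w z = (σ - w z) - (σ - w v) := by abel
    by_cases h23 : i2 = i3
    · subst h23
      by_cases h12 : i1 = i2
      · subst h12
        -- Index two: two elements of the same layer differ by an element of the next subgroup.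
        exact hne (huv' ▸ sub_mem_chain_succ hg2 hg2' hg1 hg1')
      · obtain ⟨j, hj, hj'⟩ := exists_oneCollision (w := w) hv hz hvz huv.symm huz.symm
          (c := i2 + 1) (i := i1 + 1) (hvz' ▸ sub_mem_chain_succ hg3 hg3' hg2 hg2')
          hs3 hs1
        exact hb1 j (by omega) hj'
    -- Both lower totals already lie in level `i3 + 1`, the subgroup modulo which the highest edge
    -- is separated.
    · refine hne (huv' ▸ AddSubgroup.sub_mem _ (chain_anti ?_ hg2) (chain_anti ?_ hg1)) <;> omega

theorem not_three_isGood {K : ℕ} {w : V → WeightGroup m L} {S : Finset V} {u v z : V}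
    (hu : u ∈ S) (hv : v ∈ S) (hz : z ∈ S) (huv : u ≠ v) (huz : u ≠ z) (hvz : v ≠ z)
    {σ : WeightGroup m L}
    (h1 : IsGood K w (S.erase u) (σ - w u)) (h2 : IsGood K w (S.erase v) (σ - w v))
    (h3 : IsGood K w (S.erase z) (σ - w z)) : False := by
  obtain ⟨p, hp⟩ := h1.inClass
  obtain ⟨q, hq⟩ := h2.inClass
  obtain ⟨t, ht⟩ := h3.inClass
  rcases le_total p q with h | h <;> rcases le_total q t with h' | h' <;>
    rcases le_total p t with h'' | h''
  · exact not_inClass_of_le hu hv hz huv huz hvz h h' hp hq ht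
  · exact not_inClass_of_le hu hv hz huv huz hvz h h' hp hq ht
  · exact not_inClass_of_le hu hz hv huz huv hvz.symm h'' h' hp ht hq
  · exact not_inClass_of_le hz hu hv huz.symm hvz.symm huv h'' h ht hp hq
  · exact not_inClass_of_le hv hu hz huv.symm hvz huz h h'' hq hp ht
  · exact not_inClass_of_le hv hz hu hvz huv.symm huz.symm h' h'' hq ht hp
  · exact not_inClass_of_le hz hv hu hvz.symm huz.symm huv.symm h' h ht hq hp
  · exact not_inClass_of_le hz hv hu hvz.symm huz.symm huv.symm h' h ht hq hp

open Classical in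
/-- The `r`-graph whose edges are the `r`-sets `s` that are good with respect to their total
weight shifted by `t`. -/
noncomputable def goodGraph [Fintype V] (K r : ℕ) (w : V → WeightGroup m L)
    (t : WeightGroup m L) : RGraph V r where
  edges := (Finset.univ.powersetCard r).filter (fun s => IsGood K w s (∑ a ∈ s, w a - t))
  card_eq := fun _ he => (Finset.mem_powersetCard.mp (Finset.mem_filter.mp he).1).2

theorem goodGraph_not_contains_daisy [Fintype V] (K : ℕ) {r : ℕ} (hr : 2 ≤ r)
    (w : V → WeightGroup m L) (t : WeightGroup m L) :
    ¬ (goodGraph K r w t).Contains (RGraph.daisy 3 r) := by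
  classical
  rintro ⟨f, hf⟩
  set S := Finset.univ.map f with hS
  have key : ∀ i : Fin (r + 1), i.val < 3 →
      IsGood K w (S.erase (f i)) ((∑ a ∈ S, w a - t) - w (f i)) := by
    intro i hi
    have h := (Finset.mem_filter.mp (RGraph.erase_mem_of_daisy hf hi)).2
    have hs : ∑ a ∈ S.erase (f i), w a = ∑ a ∈ S, w a - w (f i) :=
      Finset.sum_erase_eq_sub (by simp [hS])
    rw [← hS, hs, sub_right_comm] at h
    exact h
  have hmem : ∀ i, f i ∈ S := fun i => by simp [hS]
  have hne : ∀ i j : Fin (r + 1), i.val ≠ j.val → f i ≠ f j :=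
    fun i j h h' => h (congrArg Fin.val (f.injective h'))
  exact not_three_isGood (hmem ⟨0, by omega⟩) (hmem ⟨1, by omega⟩) (hmem ⟨2, by omega⟩)
    (hne _ _ (by simp)) (hne _ _ (by simp)) (hne _ _ (by simp))
    (key _ (by simp)) (key _ (by simp)) (key _ (by simp))

end Good

/-! ### Separation when the weight of one vertex is resampled. -/

section Separated

variable {V A : Type*} [DecidableEq V] [AddCommGroup A]

theorem separated_update_iff {N : Set A} {w : V → A} {s : Finset V} {a : V} (ha : a ∉ s) (x : A) :
    Separated N (Function.update w a x) s ↔ Separated N w s := by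
  have : ∀ b ∈ s, Function.update w a x b = w b := fun b hb =>
    Function.update_of_ne (by rintro rfl; exact ha hb) _ _
  constructor <;> intro h b hb c hc hbc
  · simpa [this b hb, this c hc] using h b hb c hc hbc
  · simpa [this b hb, this c hc] using h b hb c hc hbc

theorem separated_insert_update_iff {N : Set A} (hN : ∀ g ∈ N, -g ∈ N) {w : V → A} {s : Finset V}
    {a : V} (ha : a ∉ s) (x : A) :
    Separated N (Function.update w a x) (insert a s) ↔
      Separated N w s ∧ ∀ b ∈ s, x - w b ∉ N := by
  have hup : ∀ b ∈ s, Function.update w a x b = w b := fun b hb =>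
    Function.update_of_ne (by rintro rfl; exact ha hb) _ _
  rw [← separated_update_iff ha x]
  constructor
  · intro h
    refine ⟨h.mono le_rfl (Finset.subset_insert _ _), fun b hb => ?_⟩
    have := h a (Finset.mem_insert_self _ _) b (Finset.mem_insert_of_mem hb)
      (by rintro rfl; exact ha hb)
    simpa [hup b hb] using this
  · rintro ⟨h, hx⟩ b hb c hc hbc
    rcases Finset.mem_insert.mp hb with rfl | hb' <;> rcases Finset.mem_insert.mp hc with rfl | hc'
    · exact absurd rfl hbc
    · simpa [hup c hc'] using hx c hc'
    · intro hm
      have := hN _ hm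
      rw [neg_sub] at this
      exact hx b hb' (by simpa [hup b hb'] using this)
    · exact h b hb' c hc' hbc

end Separated

/-! ### Uniform probabilities and birthday-type bounds. -/

section Counting

open Classical in
/-- The proportion of the elements of a finite type that have a given property. -/
noncomputable def proportion {X : Type*} [Fintype X] (p : X → Prop) : ℝ :=
  ((Finset.univ.filter p).card : ℝ) / Fintype.card X

section Basic

variable {X : Type*} [Fintype X]

theorem proportion_nonneg (p : X → Prop) : 0 ≤ proportion p := by
  unfold proportion; positivity

theorem proportion_mono {p q : X → Prop} (h : ∀ x, p x → q x) : proportion p ≤ proportion q := by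
  classical
  unfold proportion
  gcongr
  exact h _

open Classical in
theorem proportion_eq_sum (p : X → Prop) :
    proportion p = (∑ x, if p x then (1 : ℝ) else 0) / Fintype.card X := by
  simp [proportion]

theorem proportion_comp_equiv (e : X ≃ X) (p : X → Prop) :
    proportion (fun x => p (e x)) = proportion p := by
  classical
  rw [proportion_eq_sum, proportion_eq_sum, Equiv.sum_comp e (fun x => if p x then (1 : ℝ) else 0)]

theorem proportion_not [Nonempty X] (p : X → Prop) :
    proportion (fun x => ¬ p x) = 1 - proportion p := by
  classical
  have hX : (Fintype.card X : ℝ) ≠ 0 := by exact_mod_cast Fintype.card_ne_zero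
  have h := Finset.card_filter_add_card_filter_not (s := (Finset.univ : Finset X)) p
  unfold proportion
  rw [eq_sub_iff_add_eq, ← add_div, div_eq_one_iff_eq hX, ← Nat.cast_add, add_comm]
  rw [← Finset.card_univ, ← h]
  congr!

theorem proportion_exists_le {ι : Type*} (s : Finset ι) (p : ι → X → Prop) :
    proportion (fun x => ∃ i ∈ s, p i x) ≤ ∑ i ∈ s, proportion (p i) := by
  classical
  unfold proportion
  rw [← Finset.sum_div, ← Nat.cast_sum]
  gcongr
  refine le_trans (Finset.card_le_card ?_) Finset.card_biUnion_le
  intro x hx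
  simpa using hx

theorem proportion_exists_eq {ι : Type*} (s : Finset ι) (p : ι → X → Prop)
    (hd : ∀ i ∈ s, ∀ j ∈ s, i ≠ j → ∀ x, p i x → ¬ p j x) :
    proportion (fun x => ∃ i ∈ s, p i x) = ∑ i ∈ s, proportion (p i) := by
  classical
  unfold proportion
  rw [← Finset.sum_div, ← Nat.cast_sum, ← Finset.card_biUnion]
  · congr 2
    exact congrArg _ (by ext x; simp)
  · intro i hi j hj hij
    rw [Function.onFun, Finset.disjoint_left]
    intro x hx hx'
    exact hd i hi j hj hij x (Finset.mem_filter.mp hx).2 (Finset.mem_filter.mp hx').2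

end Basic

variable {V A : Type*} [Fintype V] [DecidableEq V] [Fintype A]

/-- Resampling one coordinate of a uniformly random function leaves it uniformly random. -/
theorem sum_sum_update (a : V) (F : (V → A) → ℝ) :
    ∑ w : V → A, ∑ x : A, F (Function.update w a x) = Fintype.card A * ∑ w, F w := by
  -- Exchanging the old value at `a` with the fresh one is a bijection.
  have hinv : Function.Involutive
      (fun p : (V → A) × A => (Function.update p.1 a p.2, p.1 a)) := by
    rintro ⟨w, x⟩
    simp
  rw [← Fintype.sum_prod_type' (f := fun w x => F (Function.update w a x)),
    Fintype.sum_equiv hinv.toPerm (fun p : (V → A) × A => F (Function.update p.1 a p.2))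
      (fun p => F p.1) (fun _ => rfl),
    Fintype.sum_prod_type]
  simp [Finset.mul_sum]

open Classical in
theorem mul_proportion (t : ℝ) (q : (V → A) → Prop) :
    t * proportion q = (∑ w, if q w then t else 0) / Fintype.card (V → A) := by
  rw [proportion_eq_sum, mul_div_assoc', Finset.mul_sum]
  simp

variable [Nonempty A]

theorem proportion_eq_sum_update (a : V) (p : (V → A) → Prop) :
    proportion p =
      (∑ w : V → A, proportion (fun x => p (Function.update w a x))) / Fintype.card (V → A) := by
  classical
  have hA : (Fintype.card A : ℝ) ≠ 0 := by exact_mod_cast Fintype.card_ne_zero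
  rw [proportion_eq_sum]
  congr 1
  simp_rw [proportion_eq_sum]
  rw [← Finset.sum_div, sum_sum_update a (fun w => if p w then (1 : ℝ) else 0)]
  field_simp

theorem mul_proportion_le_of_update (a : V) {p q : (V → A) → Prop} {t : ℝ}
    (h : ∀ w, q w → t ≤ proportion (fun x => p (Function.update w a x))) :
    t * proportion q ≤ proportion p := by
  classical
  rw [proportion_eq_sum_update a p, mul_proportion]
  gcongr with w
  split_ifs with hw
  · exact h w hw
  · exact proportion_nonneg _

theorem proportion_le_mul_of_update (a : V) {p q : (V → A) → Prop} {t : ℝ}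
    (hpq : ∀ w x, p (Function.update w a x) → q w)
    (h : ∀ w, q w → proportion (fun x => p (Function.update w a x)) ≤ t) :
    proportion p ≤ t * proportion q := by
  classical
  rw [proportion_eq_sum_update a p, mul_proportion]
  gcongr with w
  split_ifs with hw
  · exact h w hw
  · have : (fun x => p (Function.update w a x)) = fun _ => False := by
      funext x
      simpa using fun hx => hw (hpq w x hx)
    rw [this]
    simp [proportion]

variable [AddCommGroup A]

/-- Union bound: the weight of the new vertex must avoid `s.card` translates of `N`. -/
theorem mul_proportion_separated_le {N : Set A} (hN : ∀ g ∈ N, -g ∈ N) {s : Finset V} {a : V}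
    (ha : a ∉ s) :
    (1 - s.card * proportion (· ∈ N)) * proportion (fun w : V → A => Separated N w s) ≤
      proportion (fun w : V → A => Separated N w (insert a s)) := by
  refine mul_proportion_le_of_update a fun w hw => ?_
  simp_rw [separated_insert_update_iff hN ha, hw, true_and]
  have h1 : (fun x => ∀ b ∈ s, x - w b ∉ N) = fun x => ¬ ∃ b ∈ s, x - w b ∈ N := by
    funext x; simp
  rw [h1, proportion_not]
  have h2 := proportion_exists_le s (fun b x => x - w b ∈ N)
  have h3 : ∀ b ∈ s, proportion (fun x => x - w b ∈ N) = proportion (· ∈ N) := fun b _ =>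
    proportion_comp_equiv (Equiv.subRight (w b)) (· ∈ N)
  rw [Finset.sum_congr rfl h3] at h2
  simp only [Finset.sum_const, nsmul_eq_mul] at h2
  linarith

/-- For a subgroup the forbidden translates are cosets, disjoint once `s` is separated, so the union
bound is an equality. -/
theorem proportion_separated_insert_le (H : AddSubgroup A) {s : Finset V} {a : V} (ha : a ∉ s) :
    proportion (fun w : V → A => Separated (H : Set A) w (insert a s)) ≤
      (1 - s.card * proportion (· ∈ H)) *
        proportion (fun w : V → A => Separated (H : Set A) w s) := by
  have hN : ∀ g ∈ (H : Set A), -g ∈ (H : Set A) := fun g hg => H.neg_mem hg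
  refine proportion_le_mul_of_update a
    (fun w x h => ((separated_insert_update_iff hN ha x).mp h).1) fun w hw => ?_
  simp_rw [separated_insert_update_iff hN ha, hw, true_and]
  have h1 : (fun x => ∀ b ∈ s, x - w b ∉ (H : Set A)) = fun x => ¬ ∃ b ∈ s, x - w b ∈ H := by
    funext x; simp
  rw [h1, proportion_not, proportion_exists_eq]
  · have h3 : ∀ b ∈ s, proportion (fun x => x - w b ∈ H) = proportion (· ∈ H) := fun b _ =>
      proportion_comp_equiv (Equiv.subRight (w b)) (· ∈ H)
    rw [Finset.sum_congr rfl h3]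
    simp
  · intro b hb c hc hbc x hx hx'
    refine hw b hb c hc hbc ?_
    have := H.sub_mem hx' hx
    rwa [sub_sub_sub_cancel_left] at this

/-- Resampling `b` leaves the separation of `s` unchanged and makes `w a - w b` uniform. -/
theorem proportion_separated_and_le (H : AddSubgroup A) (U : Set A) {s : Finset V} {a b : V}
    (hab : a ≠ b) (hb : b ∉ s) :
    proportion (fun w : V → A => Separated (H : Set A) w s ∧ w a - w b ∈ U) ≤
      proportion (· ∈ U) * proportion (fun w : V → A => Separated (H : Set A) w s) := by
  refine proportion_le_mul_of_update b
    (fun w x h => (separated_update_iff hb x).mp h.1) fun w hw => ?_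
  simp_rw [separated_update_iff hb, hw, true_and, Function.update_of_ne hab, Function.update_self]
  exact (proportion_comp_equiv (Equiv.subLeft (w a)) (· ∈ U)).le

/-- A lower bound for the probability that random weights are separated. -/
theorem exp_le_proportion_separated {N : Set A} (hN : ∀ g ∈ N, -g ∈ N) {μ τ : ℝ}
    (hμ : proportion (· ∈ N) ≤ μ) (hτ : τ < 1) (s : Finset V) (hs : s.card * μ ≤ τ) :
    Real.exp (-(s.card * (s.card - 1) / 2 * μ / (1 - τ))) ≤
      proportion (fun w : V → A => Separated N w s) := by
  have hμ0 : 0 ≤ μ := (proportion_nonneg _).trans hμ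
  induction s using Finset.induction_on with
  | empty =>
    have : (fun w : V → A => Separated N w ∅) = fun _ => True := by
      funext w; simp [Separated]
    rw [this]
    rw [proportion]
    simp [-Fintype.card_pi]
  | insert a s ha ih =>
    rw [Finset.card_insert_of_notMem ha] at hs ⊢
    push_cast at hs ⊢
    have hs' : s.card * μ ≤ τ := by nlinarith
    refine le_trans ?_ (mul_proportion_separated_le hN ha)
    have h1 : Real.exp (-(s.card * μ / (1 - τ))) ≤ 1 - s.card * proportion (· ∈ N) := by
      have h2 : s.card * proportion (· ∈ N) ≤ s.card * μ := by gcongr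
      refine le_trans ?_ (sub_le_sub_left h2 1)
      set t := s.card * μ with ht
      have ht0 : 0 ≤ t := by positivity
      have h3 : 0 < 1 - t := by linarith
      rw [← Real.le_log_iff_exp_le h3]
      -- This gives `log (1 - t) ≥ -t / (1 - t)`; enlarging the fraction by `t ≤ τ` makes the
      -- denominator uniform over all insertions.
      refine le_trans ?_ (Real.one_sub_inv_le_log_of_pos h3)
      have h4 : 1 - (1 - t)⁻¹ = -(t / (1 - t)) := by field_simp; ring
      rw [h4, neg_le_neg_iff]
      have : 0 < 1 - τ := by linarith
      gcongr
    have h5 : -((s.card + 1 : ℝ) * (s.card + 1 - 1) / 2 * μ / (1 - τ)) =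
        -(s.card * μ / (1 - τ)) + -(s.card * (s.card - 1) / 2 * μ / (1 - τ)) := by ring
    rw [h5, Real.exp_add]
    exact mul_le_mul h1 (ih hs') (Real.exp_pos _).le ((Real.exp_pos _).le.trans h1)

/-- An upper bound for the probability that random weights are in distinct cosets. -/
theorem proportion_separated_le_exp (H : AddSubgroup A) (s : Finset V) :
    proportion (fun w : V → A => Separated (H : Set A) w s) ≤
      Real.exp (-(s.card * (s.card - 1) / 2 * proportion (· ∈ H))) := by
  induction s using Finset.induction_on with
  | empty =>
    rw [proportion]
    refine (div_le_one_of_le₀ ?_ (by positivity)).trans (by simp)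
    exact_mod_cast Finset.card_le_univ _
  | insert a s ha ih =>
    rw [Finset.card_insert_of_notMem ha]
    push_cast
    refine (proportion_separated_insert_le H ha).trans ?_
    have h5 : -((s.card + 1 : ℝ) * (s.card + 1 - 1) / 2 * proportion (· ∈ H)) =
        -(s.card * proportion (· ∈ H)) + -(s.card * (s.card - 1) / 2 * proportion (· ∈ H)) := by
      ring
    rw [h5, Real.exp_add]
    refine mul_le_mul ?_ ih (proportion_nonneg _) (Real.exp_pos _).le
    have := Real.add_one_le_exp (-(s.card * proportion (· ∈ H)))
    linarith

end Counting

/-! ### Products, disjoint unions, double counting and the first moment. -/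

section ProportionLemmas

variable {X Y : Type*} [Fintype X] [Fintype Y]

theorem proportion_prod (p : X → Prop) (q : Y → Prop) :
    proportion (fun z : X × Y => p z.1 ∧ q z.2) = proportion p * proportion q := by
  classical
  unfold proportion
  rw [div_mul_div_comm, Fintype.card_prod, ← Nat.cast_mul, ← Nat.cast_mul, ← Finset.card_product,
    ← Finset.filter_product, Finset.univ_product_univ]
  congr!

theorem proportion_true [Nonempty X] : proportion (fun _ : X => True) = 1 := by
  have hX : (Fintype.card X : ℝ) ≠ 0 := by exact_mod_cast Fintype.card_ne_zero
  simp [proportion, hX]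

theorem proportion_eq_const (c : X) : proportion (fun x => x = c) = 1 / Fintype.card X := by
  classical
  rw [proportion_eq_sum]
  simp

theorem proportion_or_eq {p q : X → Prop} (h : ∀ x, p x → ¬ q x) :
    proportion (fun x => p x ∨ q x) = proportion p + proportion q := by
  classical
  unfold proportion
  rw [← add_div, ← Nat.cast_add, ← Finset.card_union_of_disjoint, ← Finset.filter_or]
  · congr!
  · rw [Finset.disjoint_filter]
    exact fun x _ => h x

theorem proportion_or_le (p q : X → Prop) :
    proportion (fun x => p x ∨ q x) ≤ proportion p + proportion q := by
  classical
  unfold proportion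
  rw [← add_div, ← Nat.cast_add]
  gcongr
  refine le_trans (le_of_eq ?_) (Finset.card_union_le _ _)
  rw [← Finset.filter_or]
  congr!

theorem two_mul_proportion_le {ι : Type*} (s : Finset ι) (p : X → Prop) (q : ι → X → Prop)
    (h : ∀ x, p x → ∃ i ∈ s, ∃ j ∈ s, i ≠ j ∧ q i x ∧ q j x) :
    2 * proportion p ≤ ∑ i ∈ s, proportion (q i) := by
  classical
  simp_rw [proportion_eq_sum]
  rw [← Finset.sum_div, ← mul_div_assoc, Finset.sum_comm, Finset.mul_sum]
  gcongr with x
  have hs : ∑ i ∈ s, (if q i x then (1 : ℝ) else 0) = ((s.filter (q · x)).card : ℝ) := by simp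
  rw [hs]
  split_ifs with hx
  · obtain ⟨i, hi, j, hj, hij, hqi, hqj⟩ := h x hx
    have : 1 < (s.filter (q · x)).card := Finset.one_lt_card.mpr
      ⟨i, Finset.mem_filter.mpr ⟨hi, hqi⟩, j, Finset.mem_filter.mpr ⟨hj, hqj⟩, hij⟩
    have h2 : (2 : ℝ) ≤ ((s.filter (q · x)).card : ℝ) := by exact_mod_cast this
    linarith
  · simp

open Classical in
/-- Some point lies in at least as many events as on average. -/
theorem exists_sum_proportion_le [Nonempty X] {ι : Type*} (s : Finset ι) (q : ι → X → Prop) :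
    ∃ x, ∑ i ∈ s, proportion (q i) ≤ ((s.filter (q · x)).card : ℝ) := by
  have hX : (Fintype.card X : ℝ) ≠ 0 := by exact_mod_cast Fintype.card_ne_zero
  obtain ⟨x, -, hx⟩ := Finset.exists_le_of_sum_le (s := (Finset.univ : Finset X))
    (f := fun _ => ∑ i ∈ s, proportion (q i))
    (g := fun x => ((s.filter (q · x)).card : ℝ)) Finset.univ_nonempty (by
      simp_rw [proportion_eq_sum]
      rw [← Finset.sum_div, Finset.sum_const, nsmul_eq_mul, Finset.card_univ,
        mul_div_cancel₀ _ hX, Finset.sum_comm]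
      simp)
  exact ⟨x, hx⟩

end ProportionLemmas

/-! ### Sizes of layers and strips. -/

namespace WeightGroup

variable {m L : ℕ}

theorem neg_mem_strip {k : ℕ} : ∀ g ∈ strip m L k, -g ∈ strip m L k := by
  rintro g ⟨j, hj, hg⟩
  exact ⟨-j, by simpa using hj, by simp [hg]⟩

variable [NeZero m]

theorem proportion_initial_zero {i : ℕ} (hi : i ≤ L) :
    proportion (fun v : Fin L → ZMod 2 => ∀ l : Fin L, l.val < i → v l = 0) = (1 / 2 : ℝ) ^ i := by
  classical
  have h1 : (Finset.univ.filter fun v : Fin L → ZMod 2 => ∀ l : Fin L, l.val < i → v l = 0) =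
      Fintype.piFinset (fun l : Fin L => if l.val < i then {0} else Finset.univ) := by
    ext v
    simp only [Finset.mem_filter, Finset.mem_univ, true_and, Fintype.mem_piFinset]
    refine forall_congr' fun l => ?_
    split_ifs with h <;> simp [h]
  have h2 : (Finset.univ.filter fun l : Fin L => ¬ l.val < i).card = L - i := by
    have h3 := Finset.card_filter_add_card_filter_not (s := (Finset.univ : Finset (Fin L)))
      (fun l => l.val < i)
    rw [Fin.card_filter_val_lt, min_eq_right hi, Finset.card_univ, Fintype.card_fin] at h3
    omega
  have h3 : (Finset.univ.filter fun v : Fin L → ZMod 2 => ∀ l : Fin L, l.val < i → v l = 0).card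
      = 2 ^ (L - i) := by
    rw [h1, Fintype.card_piFinset, ← h2, ← Finset.prod_const, Finset.prod_filter]
    refine Finset.prod_congr rfl fun l _ => ?_
    split_ifs <;> simp_all
  have h4 : proportion (fun v : Fin L → ZMod 2 => ∀ l : Fin L, l.val < i → v l = 0) =
      (2 ^ (L - i) : ℕ) / ((2 ^ L : ℕ) : ℝ) := by
    rw [← h3, proportion]
    congr! 2
    · congr!
    · simp
  rw [h4]
  push_cast
  rw [div_eq_iff (by positivity), ← Nat.sub_add_cancel hi, pow_add, Nat.add_sub_cancel, one_div,
    inv_pow]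
  field_simp

theorem proportion_chain {i : ℕ} (hi : i ≤ L) :
    proportion (· ∈ chain m L i) = (1 / 2 : ℝ) ^ i / m := by
  have := proportion_prod (fun x : ZMod m => x = 0)
    (fun v : Fin L → ZMod 2 => ∀ l : Fin L, l.val < i → v l = 0)
  rw [proportion_initial_zero hi, proportion_eq_const, ZMod.card] at this
  rw [div_eq_mul_one_div, mul_comm, ← this]
  rfl

theorem proportion_chain_diff {i : ℕ} (hi : i < L) :
    proportion (fun g => g ∈ chain m L i ∧ g ∉ chain m L (i + 1)) = (1 / 2 : ℝ) ^ (i + 1) / m := by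
  have h := proportion_or_eq (p := fun g => g ∈ chain m L i ∧ g ∉ chain m L (i + 1))
    (q := (· ∈ chain m L (i + 1))) (fun x hx => hx.2)
  have h2 : (fun g => (g ∈ chain m L i ∧ g ∉ chain m L (i + 1)) ∨ g ∈ chain m L (i + 1)) =
      (· ∈ chain m L i) := by
    funext g
    have := @chain_anti m L i (i + 1) (Nat.le_succ i) g
    simp only [eq_iff_iff]
    tauto
  rw [h2, proportion_chain hi.le, proportion_chain (Nat.succ_le_of_lt hi), Nat.succ_eq_add_one] at h
  have : (1 / 2 : ℝ) ^ i / m = 2 * ((1 / 2 : ℝ) ^ (i + 1) / m) := by ring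
  linarith

theorem proportion_fst_eq (c : ZMod m) :
    proportion (fun g : WeightGroup m L => g.1 = c) = 1 / m := by
  have := proportion_prod (fun x : ZMod m => x = c) (fun _ : Fin L → ZMod 2 => True)
  rw [proportion_true, proportion_eq_const, ZMod.card, mul_one] at this
  rw [← this]
  simp

theorem proportion_strip_le (k : ℕ) :
    proportion (· ∈ strip m L (k + 1)) ≤ (2 * k + 1) / m := by
  have h1 : (fun g => g ∈ strip m L (k + 1)) =
      fun g => ∃ j ∈ Finset.Ioo (-((k + 1 : ℕ) : ℤ)) ((k + 1 : ℕ) : ℤ), g.1 = (j : ZMod m) := by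
    funext g
    simp only [strip, abs_lt, Set.mem_ofPred_eq, Finset.mem_Ioo]
  rw [h1]
  refine (proportion_exists_le _ _).trans ?_
  simp only [proportion_fst_eq, Finset.sum_const, Int.card_Ioo, nsmul_eq_mul]
  have : (((k + 1 : ℕ) : ℤ) - -((k + 1 : ℕ) : ℤ) - 1).toNat = 2 * k + 1 := by omega
  rw [this]
  push_cast
  rw [mul_one_div]

end WeightGroup

/-! ### Expected edge density of the random good graph. -/

section Density

variable {m L : ℕ} [NeZero m] {V : Type*} [Fintype V] [DecidableEq V]

/-- A collision is counted through both of its orientations, so summing over ordered pairs costs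
only half. For each pair, membership of the difference in the layer and separation of the other
`s.card - 1` vertices are handled by resampling. -/
theorem proportion_oneCollision_le {j : ℕ} (hj : j < L) (s : Finset V) :
    proportion (fun w : V → WeightGroup m L => OneCollision w s j) ≤
      s.card * (s.card - 1) / 2 * ((1 / 2 : ℝ) ^ (j + 1) / m) *
        Real.exp (-((s.card - 1) * (s.card - 2) / 2 * ((1 / 2 : ℝ) ^ j / m))) := by
  set B : ℝ := (1 / 2 : ℝ) ^ (j + 1) / m *
    Real.exp (-((s.card - 1) * (s.card - 2) / 2 * ((1 / 2 : ℝ) ^ j / m))) with hB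
  have h1 := two_mul_proportion_le s.offDiag
    (fun w : V → WeightGroup m L => OneCollision w s j)
    (fun c w => Separated (chain m L j : Set (WeightGroup m L)) w (s.erase c.2) ∧
      w c.1 - w c.2 ∈ {g | g ∈ chain m L j ∧ g ∉ chain m L (j + 1)}) (by
      rintro w ⟨a, ha, b, hb, hab, hc, hc', hsep⟩
      have hswap : ∀ i, w b - w a ∈ chain m L i ↔ w a - w b ∈ chain m L i := fun i => by
        rw [← neg_sub, AddSubgroup.neg_mem_iff]
      refine ⟨(a, b), by simp [ha, hb, hab], (b, a), by simp [ha, hb, hab.symm],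
        by simp [hab], ⟨hsep, hc, hc'⟩, ?_, (hswap j).mpr hc, fun h => hc' ((hswap _).mp h)⟩
      -- Since `a` and `b` agree modulo level `j`, either may stand in for the other, so `s.erase a`
      -- is separated too.
      intro x hx y hy hxy hm
      obtain ⟨hxa, hxs⟩ := Finset.mem_erase.mp hx
      obtain ⟨hya, hys⟩ := Finset.mem_erase.mp hy
      by_cases hxb : x = b
      · subst hxb
        refine hsep a (Finset.mem_erase.mpr ⟨hab, ha⟩) y (Finset.mem_erase.mpr ⟨hxy.symm, hys⟩)
          hya.symm ?_
        rw [← sub_add_sub_cancel (w a) (w x) (w y)]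
        exact AddSubgroup.add_mem _ hc hm
      by_cases hyb : y = b
      · subst hyb
        refine hsep x (Finset.mem_erase.mpr ⟨hxy, hxs⟩) a (Finset.mem_erase.mpr ⟨hab, ha⟩)
          hxa ?_
        rw [← sub_add_sub_cancel (w x) (w y) (w a)]
        exact AddSubgroup.add_mem _ hm ((hswap j).mpr hc)
      exact hsep x (Finset.mem_erase.mpr ⟨hxb, hxs⟩) y (Finset.mem_erase.mpr ⟨hyb, hys⟩) hxy hm)
  have h2 : ∀ c ∈ s.offDiag, proportion (fun w : V → WeightGroup m L =>
      Separated (chain m L j : Set (WeightGroup m L)) w (s.erase c.2) ∧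
      w c.1 - w c.2 ∈ {g | g ∈ chain m L j ∧ g ∉ chain m L (j + 1)}) ≤ B := by
    rintro ⟨a, b⟩ hc
    obtain ⟨ha, hb, hab⟩ := Finset.mem_offDiag.mp hc
    have hcard : ((s.erase b).card : ℝ) = s.card - 1 := by
      rw [Finset.card_erase_of_mem hb, Nat.cast_sub (Finset.card_pos.mpr ⟨b, hb⟩), Nat.cast_one]
    refine (proportion_separated_and_le _ _ hab (Finset.notMem_erase b s)).trans ?_
    have h3 := proportion_separated_le_exp (V := V) (chain m L j) (s.erase b)
    have h4 : proportion (· ∈ {g | g ∈ chain m L j ∧ g ∉ chain m L (j + 1)}) = _ :=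
      proportion_chain_diff (m := m) hj
    rw [h4, hB]
    refine mul_le_mul_of_nonneg_left (h3.trans (le_of_eq ?_)) (by positivity)
    rw [proportion_chain hj.le, hcard]
    congr 1
    ring
  have h3 := h1.trans (Finset.sum_le_sum h2)
  rw [Finset.sum_const, nsmul_eq_mul, Finset.offDiag_card,
    Nat.cast_sub (Nat.le_mul_self _), Nat.cast_mul] at h3
  rw [mul_assoc, ← hB]
  linarith

/-- A lower bound for the edge density of a random good `r`-graph. -/
noncomputable def densityBound (m L K r : ℕ) : ℝ :=
  ∑ k ∈ Finset.range K, 1 / m *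
      Real.exp (-(r * (r - 1) / 2 * ((2 * k + 1) / m) / (1 - r * (2 * K + 1) / m))) +
    ∑ i ∈ Finset.range L, (1 / 2 : ℝ) ^ (i + 1) / m *
      (Real.exp (-(r * (r - 1) / 2 * ((1 / 2 : ℝ) ^ (i + 1) / m) / (1 - r * (2 * K + 1) / m))) -
        ∑ j ∈ Finset.range (i + 1), r * (r - 1) / 2 * ((1 / 2 : ℝ) ^ (j + 1) / m) *
          Real.exp (-((r - 1) * (r - 2) / 2 * ((1 / 2 : ℝ) ^ j / m))))

theorem le_proportion_strip {K : ℕ} (s : Finset V)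
    (hm : s.card * (2 * K + 1) < (m : ℝ)) {k : ℕ} (hk : k < K) :
    1 / m * Real.exp (-(s.card * (s.card - 1) / 2 *
      ((2 * k + 1) / m) / (1 - s.card * (2 * K + 1) / m))) ≤
      proportion (fun p : (V → WeightGroup m L) × WeightGroup m L =>
        Separated (strip m L (k + 1)) p.1 s ∧ p.2.1 = ((k + 1 : ℕ) : ZMod m)) := by
  have hm0 : (0 : ℝ) < m := by exact_mod_cast NeZero.pos m
  have hτ : (s.card * (2 * K + 1) : ℝ) / m < 1 := (div_lt_one hm0).mpr hm
  have hk' : (k : ℝ) ≤ K := by exact_mod_cast hk.le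
  rw [proportion_prod (fun w : V → WeightGroup m L => Separated (strip m L (k + 1)) w s)
    (fun g : WeightGroup m L => g.1 = ((k + 1 : ℕ) : ZMod m)), proportion_fst_eq, mul_comm]
  refine mul_le_mul_of_nonneg_right ?_ (by positivity)
  refine exp_le_proportion_separated neg_mem_strip (proportion_strip_le k) hτ s ?_
  rw [← mul_div_assoc]
  gcongr

/-- The excluded collisions are simply subtracted by a union bound over the levels `j ≤ i`. -/
theorem le_proportion_chain {K : ℕ} (s : Finset V)
    (hm : s.card * (2 * K + 1) < (m : ℝ)) {i : ℕ} (hi : i < L) :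
    (1 / 2 : ℝ) ^ (i + 1) / m *
      (Real.exp (-(s.card * (s.card - 1) / 2 * ((1 / 2 : ℝ) ^ (i + 1) / m) /
        (1 - s.card * (2 * K + 1) / m))) -
        ∑ j ∈ Finset.range (i + 1), s.card * (s.card - 1) / 2 * ((1 / 2 : ℝ) ^ (j + 1) / m) *
          Real.exp (-((s.card - 1) * (s.card - 2) / 2 * ((1 / 2 : ℝ) ^ j / m)))) ≤
      proportion (fun p : (V → WeightGroup m L) × WeightGroup m L =>
        (Separated (chain m L (i + 1) : Set (WeightGroup m L)) p.1 s ∧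
          ∀ j ≤ i, ¬ OneCollision p.1 s j) ∧ p.2 ∈ chain m L i ∧ p.2 ∉ chain m L (i + 1)) := by
  have hm0 : (0 : ℝ) < m := by exact_mod_cast NeZero.pos m
  have hτ : (s.card * (2 * K + 1) : ℝ) / m < 1 := (div_lt_one hm0).mpr hm
  rw [proportion_prod (fun w : V → WeightGroup m L =>
      Separated (chain m L (i + 1) : Set (WeightGroup m L)) w s ∧ ∀ j ≤ i, ¬ OneCollision w s j)
    (fun g : WeightGroup m L => g ∈ chain m L i ∧ g ∉ chain m L (i + 1)),
    proportion_chain_diff hi, mul_comm]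
  refine mul_le_mul_of_nonneg_right ?_ (by positivity)
  have h1 : Real.exp (-(s.card * (s.card - 1) / 2 * ((1 / 2 : ℝ) ^ (i + 1) / m) /
      (1 - s.card * (2 * K + 1) / m))) ≤ proportion (fun w : V → WeightGroup m L =>
        Separated (chain m L (i + 1) : Set (WeightGroup m L)) w s) := by
    refine exp_le_proportion_separated (N := (chain m L (i + 1) : Set (WeightGroup m L)))
      (fun g hg => AddSubgroup.neg_mem _ hg)
      (proportion_chain hi).le hτ s ?_
    rw [← mul_div_assoc]
    gcongr
    refine (pow_le_one₀ (by norm_num) (by norm_num)).trans ?_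
    have : (0 : ℝ) ≤ K := Nat.cast_nonneg K
    linarith
  have h2 : proportion (fun w : V → WeightGroup m L =>
        Separated (chain m L (i + 1) : Set (WeightGroup m L)) w s) ≤
      proportion (fun w : V → WeightGroup m L =>
        Separated (chain m L (i + 1) : Set (WeightGroup m L)) w s ∧
          ∀ j ≤ i, ¬ OneCollision w s j) +
      proportion (fun w : V → WeightGroup m L =>
        ∃ j ∈ Finset.range (i + 1), OneCollision w s j) := by
    refine le_trans (proportion_mono fun w hw => ?_) (proportion_or_le _ _)
    by_cases h : ∃ j ∈ Finset.range (i + 1), OneCollision w s j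
    · exact Or.inr h
    · push Not at h
      exact Or.inl ⟨hw, fun j hj => h j (Finset.mem_range_succ_iff.mpr hj)⟩
  have h3 := (proportion_exists_le (Finset.range (i + 1))
    (fun j (w : V → WeightGroup m L) => OneCollision w s j)).trans
    (Finset.sum_le_sum fun j hj => proportion_oneCollision_le
      ((Finset.mem_range_succ_iff.mp hj).trans_lt hi) s)
  linarith

/-- The classes are disjoint, so their probabilities add: `K < m` keeps the residues `1, …, K`
distinct and nonzero, and distinct layers are disjoint. -/
theorem densityBound_le_proportion {K : ℕ} (s : Finset V) (hm : s.card * (2 * K + 1) < (m : ℝ))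
    (hKm : K < m) :
    densityBound m L K s.card ≤
      proportion (fun p : (V → WeightGroup m L) × WeightGroup m L => IsGood K p.1 s p.2) := by
  refine (add_le_add (Finset.sum_le_sum fun k hk =>
    le_proportion_strip (L := L) s hm (Finset.mem_range.mp hk)) (Finset.sum_le_sum fun i hi =>
    le_proportion_chain s hm (Finset.mem_range.mp hi))).trans ?_
  rw [← proportion_exists_eq, ← proportion_exists_eq, ← proportion_or_eq]
  · refine proportion_mono ?_
    rintro ⟨w, g⟩ (⟨k, hk, h1, h2⟩ | ⟨i, hi, ⟨h1, h1'⟩, h2, h3⟩)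
    · exact Or.inl ⟨k + 1, by omega, Finset.mem_range.mp hk, h2, h1⟩
    · exact Or.inr ⟨i, Finset.mem_range.mp hi, h2, h3, h1, h1'⟩
  · rintro ⟨w, g⟩ ⟨k, hk, h1, h2⟩ ⟨i, hi, -, h3, -⟩
    have hk' := Finset.mem_range.mp hk
    simp only at h2
    rw [h3.1, eq_comm, ZMod.natCast_eq_zero_iff] at h2
    exact absurd (Nat.le_of_dvd (by omega) h2) (by omega)
  · rintro i - i' - hii' ⟨w, g⟩ ⟨-, h1, h2⟩ ⟨-, h1', h2'⟩
    rcases lt_or_gt_of_ne hii' with h | h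
    · exact h2 (chain_anti h h1')
    · exact h2' (chain_anti h h1)
  · rintro k hk k' hk' hkk' ⟨w, g⟩ ⟨-, h1⟩ ⟨-, h1'⟩
    have hk1 := Finset.mem_range.mp hk
    have hk2 := Finset.mem_range.mp hk'
    simp only at h1 h1'
    rw [h1, ZMod.natCast_eq_natCast_iff, Nat.ModEq, Nat.mod_eq_of_lt (by omega),
      Nat.mod_eq_of_lt (by omega)] at h1'
    omega

theorem densityBound_le_turanDensity (L : ℕ) {K r : ℕ} (hr : 2 ≤ r)
    (hm : r * (2 * K + 1) < (m : ℝ)) (hKm : K < m) :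
    densityBound m L K r ≤ RGraph.turanDensity (RGraph.daisy 3 r) := by
  classical
  refine RGraph.le_turanDensity (RGraph.daisy_edges_nonempty 2 r) fun n => ?_
  obtain ⟨⟨w, t⟩, hwt⟩ := exists_sum_proportion_le
    (X := (Fin n → WeightGroup m L) × WeightGroup m L)
    ((Finset.univ : Finset (Fin n)).powersetCard r)
    (fun s p => IsGood K p.1 s (∑ a ∈ s, p.1 a - p.2))
  have h1 : ((goodGraph K r w t).edges.card : ℝ) ≤ RGraph.turanNumber n (RGraph.daisy 3 r) := by
    exact_mod_cast RGraph.card_edges_le_turanNumber (goodGraph_not_contains_daisy K hr w t)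
  have h2 : ∀ s ∈ (Finset.univ : Finset (Fin n)).powersetCard r, densityBound m L K r ≤
      proportion (fun p : (Fin n → WeightGroup m L) × WeightGroup m L =>
        IsGood K p.1 s (∑ a ∈ s, p.1 a - p.2)) := by
    intro s hs
    have hs' := (Finset.mem_powersetCard.mp hs).2
    -- For fixed weights, reflecting the shift makes the shifted total uniform, hence independent of
    -- the weights.
    have hinv : Function.Involutive (fun p : (Fin n → WeightGroup m L) × WeightGroup m L =>
        (p.1, ∑ a ∈ s, p.1 a - p.2)) := by
      rintro ⟨w, g⟩
      simp
    have h3 := proportion_comp_equiv hinv.toPerm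
      (fun p : (Fin n → WeightGroup m L) × WeightGroup m L => IsGood K p.1 s p.2)
    refine le_trans ?_ h3.ge
    rw [← hs'] at hm ⊢
    exact densityBound_le_proportion s hm hKm
  have h3 := Finset.sum_le_sum h2
  rw [Finset.sum_const, Finset.card_powersetCard, Finset.card_univ, Fintype.card_fin,
    nsmul_eq_mul] at h3
  rw [mul_comm]
  refine h3.trans (hwt.trans (le_trans (le_of_eq ?_) h1))
  unfold goodGraph
  congr!

end Density

/-! ### The limit `r → ∞` with `m` of order `r ^ 2`. -/

section Asymptotics

/-- Interchange of summation: the factors `(1 / 2) ^ (i + 1)` with `j ≤ i < n` add up to `(1 / 2) ^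
j - (1 / 2) ^ n`. -/
theorem sum_sum_geometric_add (c : ℕ → ℝ) (n : ℕ) :
    ∑ i ∈ Finset.range n, (1 / 2 : ℝ) ^ (i + 1) * ∑ j ∈ Finset.range (i + 1), c j +
      (1 / 2 : ℝ) ^ n * ∑ j ∈ Finset.range n, c j = ∑ j ∈ Finset.range n, (1 / 2 : ℝ) ^ j * c j := by
  induction n with
  | zero => simp
  | succ n ih =>
    rw [Finset.sum_range_succ, Finset.sum_range_succ (fun j => (1 / 2 : ℝ) ^ j * c j), ← ih,
      Finset.sum_range_succ c]
    ring

/-- The limit of `r ^ 2 * densityBound ⌈r ^ 2 / (2 * x)⌉ N N r` as `r → ∞`. -/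
noncomputable def limitDensity (x : ℝ) (N : ℕ) : ℝ :=
  ∑ k ∈ Finset.range N, 2 * x * Real.exp (-((2 * k + 1) * x)) +
    ∑ i ∈ Finset.range N, (1 / 2 : ℝ) ^ (i + 1) * (2 * x) *
      (Real.exp (-((1 / 2 : ℝ) ^ (i + 1) * x)) -
        ∑ j ∈ Finset.range (i + 1), (1 / 2 : ℝ) ^ (j + 1) * x * Real.exp (-((1 / 2 : ℝ) ^ j * x)))

/-- Partial sums of the series that define `turanSeriesF`. -/
noncomputable def partialF (x : ℝ) (N : ℕ) : ℝ :=
  2 * x * Real.exp (-x) * ∑ k ∈ Finset.range N, Real.exp (-2 * x) ^ k +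
    2 * x * ∑ j ∈ Finset.range N, (1 / 2 : ℝ) ^ (j + 1) * Real.exp (-((1 / 2 : ℝ) ^ (j + 1) * x)) -
    4 * x ^ 2 * ∑ j ∈ Finset.range N, (1 / 2 : ℝ) ^ (2 * (j + 1)) *
      Real.exp (-((1 / 2 : ℝ) ^ j * x))

/-- After the interchange, the two sides differ by the nonnegative boundary term with factor `(1 /
2) ^ N`. -/
theorem partialF_le_limitDensity {x : ℝ} (hx : 0 < x) (N : ℕ) :
    partialF x N ≤ limitDensity x N := by
  set c : ℕ → ℝ := fun j => (1 / 2 : ℝ) ^ (j + 1) * x * Real.exp (-((1 / 2 : ℝ) ^ j * x)) with hc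
  have h1 : 2 * x * Real.exp (-x) * ∑ k ∈ Finset.range N, Real.exp (-2 * x) ^ k =
      ∑ k ∈ Finset.range N, 2 * x * Real.exp (-((2 * k + 1) * x)) := by
    rw [Finset.mul_sum]
    refine Finset.sum_congr rfl fun k _ => ?_
    rw [mul_assoc, ← Real.exp_nat_mul, ← Real.exp_add]
    congr 2
    ring
  have h2 : 4 * x ^ 2 * ∑ j ∈ Finset.range N, (1 / 2 : ℝ) ^ (2 * (j + 1)) *
      Real.exp (-((1 / 2 : ℝ) ^ j * x)) =
      2 * x * ∑ j ∈ Finset.range N, (1 / 2 : ℝ) ^ j * c j := by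
    rw [Finset.mul_sum, Finset.mul_sum]
    refine Finset.sum_congr rfl fun j _ => ?_
    rw [hc]
    ring
  have h3 : ∑ i ∈ Finset.range N, (1 / 2 : ℝ) ^ (i + 1) * (2 * x) *
      (Real.exp (-((1 / 2 : ℝ) ^ (i + 1) * x)) - ∑ j ∈ Finset.range (i + 1), c j) =
      2 * x * ∑ j ∈ Finset.range N, (1 / 2 : ℝ) ^ (j + 1) *
        Real.exp (-((1 / 2 : ℝ) ^ (j + 1) * x)) -
      2 * x * ∑ i ∈ Finset.range N, (1 / 2 : ℝ) ^ (i + 1) * ∑ j ∈ Finset.range (i + 1), c j := by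
    rw [← mul_sub, ← Finset.sum_sub_distrib, Finset.mul_sum]
    refine Finset.sum_congr rfl fun i _ => ?_
    ring
  have h4 : 0 ≤ 2 * x * ((1 / 2 : ℝ) ^ N * ∑ j ∈ Finset.range N, c j) := by
    have : 0 ≤ ∑ j ∈ Finset.range N, c j := Finset.sum_nonneg fun j _ => by positivity
    positivity
  rw [partialF, limitDensity, h1, h2, h3, ← sum_sum_geometric_add]
  linarith

theorem tendsto_partialF {x : ℝ} (hx : 0 < x) :
    Tendsto (partialF x) atTop (𝓝 (turanSeriesF x)) := by
  have hlt : Real.exp (-2 * x) < 1 := Real.exp_lt_one_iff.mpr (by linarith)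
  have h1 := (hasSum_geometric_of_lt_one (Real.exp_pos (-2 * x)).le hlt).tendsto_sum_nat
  have h2 := (summable_turanSeriesF_first hx.le).hasSum.tendsto_sum_nat
  have h3 := (summable_turanSeriesF_second hx.le).hasSum.tendsto_sum_nat
  exact ((h1.const_mul (2 * x * Real.exp (-x))).add (h2.const_mul (2 * x))).sub
    (h3.const_mul (4 * x ^ 2))

theorem tendsto_sq_div_ceil {x : ℝ} (hx : 0 < x) :
    Tendsto (fun r : ℕ => (r : ℝ) ^ 2 / (⌈(r : ℝ) ^ 2 / (2 * x)⌉₊ : ℝ)) atTop (𝓝 (2 * x)) := by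
  have h0 : Tendsto (fun r : ℕ => (r : ℝ) ^ 2 / (2 * x)) atTop atTop :=
    ((tendsto_pow_atTop two_ne_zero).comp tendsto_natCast_atTop_atTop).atTop_div_const
      (by positivity)
  have h1 := ((tendsto_nat_ceil_div_atTop (R := ℝ)).comp h0).inv₀ one_ne_zero
  have h2 := h1.const_mul (2 * x)
  rw [inv_one, mul_one] at h2
  refine h2.congr fun r => ?_
  simp only [Function.comp_apply, inv_div]
  field_simp

theorem tendsto_sq_mul_densityBound {x : ℝ} (hx : 0 < x) (N : ℕ) :
    Tendsto (fun r : ℕ => (r : ℝ) ^ 2 * densityBound ⌈(r : ℝ) ^ 2 / (2 * x)⌉₊ N N r) atTop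
      (𝓝 (limitDensity x N)) := by
  have ha := tendsto_sq_div_ceil hx
  set a : ℕ → ℝ := fun r => (r : ℝ) ^ 2 / (⌈(r : ℝ) ^ 2 / (2 * x)⌉₊ : ℝ) with ha_def
  have hh : Tendsto (fun r : ℕ => (r : ℝ)⁻¹) atTop (𝓝 0) := tendsto_inv_atTop_nhds_zero_nat
  -- The correction `1 - τ` tends to 1 because `r (2 N + 1) / m` is of order `1 / r` for fixed `N`.
  have hd : Tendsto (fun r : ℕ => 1 - a r * (r : ℝ)⁻¹ * (2 * N + 1)) atTop (𝓝 1) := by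
    simpa using ((ha.mul hh).mul_const (2 * (N : ℝ) + 1)).const_sub 1
  have hq : Tendsto (fun r : ℕ => (1 - (r : ℝ)⁻¹) / 2) atTop (𝓝 (1 / 2)) := by
    simpa using (hh.const_sub 1).div_const 2
  have hq2 : Tendsto (fun r : ℕ => (1 - (r : ℝ)⁻¹) * (1 - 2 * (r : ℝ)⁻¹) / 2) atTop
      (𝓝 (1 / 2)) := by
    simpa using ((hh.const_sub 1).mul ((hh.const_mul 2).const_sub 1)).div_const 2
  have hexp : ∀ t : ℝ, Tendsto (fun r : ℕ => Real.exp (-((1 - (r : ℝ)⁻¹) / 2 * (t * a r) /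
      (1 - a r * (r : ℝ)⁻¹ * (2 * N + 1))))) atTop (𝓝 (Real.exp (-(t * x)))) := by
    intro t
    have h := ((hq.mul (ha.const_mul t)).div hd one_ne_zero).neg
    have h' : -(1 / 2 * (t * (2 * x)) / 1) = -(t * x) := by ring
    rw [h'] at h
    exact (Real.continuous_exp.tendsto _).comp h
  have hexp2 : ∀ t : ℝ, Tendsto (fun r : ℕ => Real.exp (-((1 - (r : ℝ)⁻¹) *
      (1 - 2 * (r : ℝ)⁻¹) / 2 * (t * a r)))) atTop (𝓝 (Real.exp (-(t * x)))) := by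
    intro t
    have h := (hq2.mul (ha.const_mul t)).neg
    have h' : -(1 / 2 * (t * (2 * x))) = -(t * x) := by ring
    rw [h'] at h
    exact (Real.continuous_exp.tendsto _).comp h
  have hmain : Tendsto (fun r : ℕ =>
      ∑ k ∈ Finset.range N, a r * Real.exp (-((1 - (r : ℝ)⁻¹) / 2 * ((2 * k + 1) * a r) /
        (1 - a r * (r : ℝ)⁻¹ * (2 * N + 1)))) +
      ∑ i ∈ Finset.range N, (1 / 2 : ℝ) ^ (i + 1) * a r *
        (Real.exp (-((1 - (r : ℝ)⁻¹) / 2 * ((1 / 2 : ℝ) ^ (i + 1) * a r) /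
          (1 - a r * (r : ℝ)⁻¹ * (2 * N + 1)))) -
        ∑ j ∈ Finset.range (i + 1), (1 - (r : ℝ)⁻¹) / 2 * ((1 / 2 : ℝ) ^ (j + 1) * a r) *
          Real.exp (-((1 - (r : ℝ)⁻¹) * (1 - 2 * (r : ℝ)⁻¹) / 2 * ((1 / 2 : ℝ) ^ j * a r)))))
      atTop (𝓝 (limitDensity x N)) := by
    refine Tendsto.add (tendsto_finsetSum _ fun k _ => ha.mul (hexp _))
      (tendsto_finsetSum _ fun i _ => (ha.const_mul _).mul
        ((hexp _).sub (tendsto_finsetSum _ fun j _ => Tendsto.mul ?_ (hexp2 _))))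
    have h := hq.mul (ha.const_mul ((1 / 2 : ℝ) ^ (j + 1)))
    have h' : 1 / 2 * ((1 / 2 : ℝ) ^ (j + 1) * (2 * x)) = (1 / 2 : ℝ) ^ (j + 1) * x := by ring
    rwa [h'] at h
  refine hmain.congr' ?_
  filter_upwards [eventually_ge_atTop 1] with r hr
  have hr0 : (r : ℝ) ≠ 0 := by exact_mod_cast (by omega : r ≠ 0)
  have e1 : a r * (r : ℝ)⁻¹ = r / (⌈(r : ℝ) ^ 2 / (2 * x)⌉₊ : ℝ) := by
    rw [ha_def]; field_simp
  have e2 : ∀ t : ℝ, (1 - (r : ℝ)⁻¹) / 2 * (t * a r) =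
      r * (r - 1) / 2 * (t / (⌈(r : ℝ) ^ 2 / (2 * x)⌉₊ : ℝ)) := by
    intro t
    rw [ha_def]; field_simp
  have e3 : ∀ t : ℝ, (1 - (r : ℝ)⁻¹) * (1 - 2 * (r : ℝ)⁻¹) / 2 * (t * a r) =
      (r - 1) * (r - 2) / 2 * (t / (⌈(r : ℝ) ^ 2 / (2 * x)⌉₊ : ℝ)) := by
    intro t
    rw [ha_def]; field_simp
  have e4 : ∀ t : ℝ, t * a r = r ^ 2 * (t / (⌈(r : ℝ) ^ 2 / (2 * x)⌉₊ : ℝ)) := by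
    intro t
    rw [ha_def]; ring
  simp only [e1, e2, e3]
  rw [densityBound, mul_add ((r : ℝ) ^ 2), Finset.mul_sum, Finset.mul_sum]
  refine congrArg₂ _ (Finset.sum_congr rfl fun k _ => ?_) (Finset.sum_congr rfl fun i _ => ?_)
  · rw [← one_mul (a r), e4, div_mul_eq_mul_div (r : ℝ), mul_assoc]
  · rw [e4, div_mul_eq_mul_div (r : ℝ), mul_assoc]

theorem eventually_le_sq_mul_turanDensity {x c : ℝ} (hx : 0 < x) (hc : c < turanSeriesF x) :
    ∀ᶠ r : ℕ in atTop, c ≤ (r : ℝ) ^ 2 * RGraph.turanDensity (RGraph.daisy 3 r) := by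
  obtain ⟨N, hN⟩ := ((tendsto_partialF hx).eventually (lt_mem_nhds hc)).exists
  have hN' := hN.trans_le (partialF_le_limitDensity hx N)
  -- This threshold makes `r (2 N + 1)` smaller than `r ^ 2 / (2 * x)`, hence smaller than `m`.
  have hlin : ∀ᶠ r : ℕ in atTop, (2 * N + 1 : ℝ) * (2 * x) + 1 ≤ r :=
    tendsto_natCast_atTop_atTop.eventually_ge_atTop _
  filter_upwards [(tendsto_sq_mul_densityBound hx N).eventually (lt_mem_nhds hN'),
    eventually_ge_atTop 2, hlin] with r h1 h2 h3
  set m := ⌈(r : ℝ) ^ 2 / (2 * x)⌉₊ with hm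
  have hr : (2 : ℝ) ≤ r := by exact_mod_cast h2
  have hm1 : (r : ℝ) * (2 * N + 1) < m := by
    refine lt_of_lt_of_le ?_ (Nat.le_ceil _)
    rw [lt_div_iff₀ (by positivity)]
    nlinarith
  have hN0 : (0 : ℝ) ≤ N := Nat.cast_nonneg N
  have hm2 : N < m := by
    have : (N : ℝ) < m := by nlinarith
    exact_mod_cast this
  have : NeZero m := ⟨by omega⟩
  exact h1.le.trans (mul_le_mul_of_nonneg_left
    (densityBound_le_turanDensity N h2 hm1 hm2) (by positivity))

theorem exists_tendsto_zero_le_turanDensity {x c : ℝ} (hx : 0 < x) (hc : c < turanSeriesF x) :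
    ∃ δ : ℕ → ℝ, Tendsto δ atTop (𝓝 0) ∧ ∀ r : ℕ, 2 ≤ r →
      (c - δ r) / (r : ℝ) ^ 2 ≤ RGraph.turanDensity (RGraph.daisy 3 r) := by
  -- The error is the actual shortfall; it vanishes for large `r` and absorbs all small `r`.
  refine ⟨fun r => max 0 (c - (r : ℝ) ^ 2 * RGraph.turanDensity (RGraph.daisy 3 r)), ?_, ?_⟩
  · refine tendsto_const_nhds.congr' ?_
    filter_upwards [eventually_le_sq_mul_turanDensity hx hc] with r hr
    rw [max_eq_left (by linarith)]
  · intro r hr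
    have hr0 : (0 : ℝ) < r := by exact_mod_cast (by omega : 0 < r)
    rw [div_le_iff₀ (by positivity)]
    have := le_max_right 0 (c - (r : ℝ) ^ 2 * RGraph.turanDensity (RGraph.daisy 3 r))
    linarith

end Asymptotics

/-! ### Numerical lower bound for `F(1.065)`. -/

section Numerics

theorem exp_sq_bounds {y a b a' b' : ℝ} (h : a ≤ Real.exp (-(y / 2)) ∧ Real.exp (-(y / 2)) ≤ b)
    (ha : 0 ≤ a) (haa : a' ≤ a ^ 2) (hbb : b ^ 2 ≤ b') :
    a' ≤ Real.exp (-y) ∧ Real.exp (-y) ≤ b' := by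
  have hy : Real.exp (-y) = Real.exp (-(y / 2)) ^ 2 := by
    rw [← Real.exp_nat_mul]
    congr 1
    push_cast
    ring
  rw [hy]
  exact ⟨haa.trans (pow_le_pow_left₀ ha h.1 2),
    (pow_le_pow_left₀ (Real.exp_pos _).le h.2 2).trans hbb⟩

/-- A lower bound for `turanSeriesF` by finite sums. -/
theorem le_turanSeriesF {x : ℝ} (hx : 0 < x) (n : ℕ) :
    2 * x * Real.exp (-x) / (1 - Real.exp (-x) ^ 2) +
      2 * x * (∑ j ∈ Finset.range n, (1 / 2 : ℝ) ^ (j + 1) *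
        Real.exp (-((1 / 2 : ℝ) ^ (j + 1) * x)) +
        (1 / 2 : ℝ) ^ n * Real.exp (-((1 / 2 : ℝ) ^ n * x))) -
      4 * x ^ 2 * (∑ j ∈ Finset.range n, (1 / 2 : ℝ) ^ (2 * (j + 1)) *
        Real.exp (-((1 / 2 : ℝ) ^ j * x)) + (1 / 4 : ℝ) ^ n / 3) ≤ turanSeriesF x := by
  have h0 : Real.exp (-2 * x) = Real.exp (-x) ^ 2 := by
    rw [← Real.exp_nat_mul]
    congr 1
    push_cast
    ring
  -- In this tail every exponential is at least `exp (-(2⁻ⁿ x))`; in the subtracted tail below each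
  -- is at most 1.
  have h1 : (1 / 2 : ℝ) ^ n * Real.exp (-((1 / 2 : ℝ) ^ n * x)) ≤
      ∑' j : ℕ, (1 / 2 : ℝ) ^ (j + n + 1) * Real.exp (-((1 / 2 : ℝ) ^ (j + n + 1) * x)) := by
    have hs : HasSum (fun j : ℕ => (1 / 2 : ℝ) ^ j *
        ((1 / 2 : ℝ) ^ (n + 1) * Real.exp (-((1 / 2 : ℝ) ^ n * x))))
        (2 * ((1 / 2 : ℝ) ^ (n + 1) * Real.exp (-((1 / 2 : ℝ) ^ n * x)))) :=
      hasSum_geometric_two.mul_right _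
    have he : (1 / 2 : ℝ) ^ n * Real.exp (-((1 / 2 : ℝ) ^ n * x)) =
        2 * ((1 / 2 : ℝ) ^ (n + 1) * Real.exp (-((1 / 2 : ℝ) ^ n * x))) := by ring
    rw [he, ← hs.tsum_eq]
    refine hs.summable.tsum_le_tsum (fun j => ?_)
      ((summable_nat_add_iff n).mpr (summable_turanSeriesF_first hx.le))
    rw [← mul_assoc, ← pow_add, ← add_assoc]
    gcongr (1 / 2 : ℝ) ^ (j + n + 1) * Real.exp (-(?_ * x))
    exact pow_le_pow_of_le_one (by norm_num) (by norm_num) (by omega)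
  have h2 : ∑' j : ℕ, (1 / 2 : ℝ) ^ (2 * (j + n + 1)) * Real.exp (-((1 / 2 : ℝ) ^ (j + n) * x)) ≤
      (1 / 4 : ℝ) ^ n / 3 := by
    have hs : HasSum (fun j : ℕ => (1 / 4 : ℝ) ^ j * (1 / 4 : ℝ) ^ (n + 1))
        ((1 - 1 / 4)⁻¹ * (1 / 4 : ℝ) ^ (n + 1)) :=
      (hasSum_geometric_of_lt_one (by norm_num) (by norm_num)).mul_right _
    have he : (1 / 4 : ℝ) ^ n / 3 = (1 - 1 / 4)⁻¹ * (1 / 4 : ℝ) ^ (n + 1) := by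
      rw [pow_succ]; ring
    rw [he, ← hs.tsum_eq]
    refine Summable.tsum_le_tsum (fun j => ?_)
      ((summable_nat_add_iff n).mpr (summable_turanSeriesF_second hx.le)) hs.summable
    rw [← pow_add, pow_mul, ← add_assoc]
    have : (1 / 2 : ℝ) ^ 2 = 1 / 4 := by norm_num
    rw [this]
    refine mul_le_of_le_one_right (by positivity) (Real.exp_le_one_iff.mpr ?_)
    have : 0 ≤ (1 / 2 : ℝ) ^ (j + n) * x := by positivity
    linarith
  rw [turanSeriesF, h0, ← (summable_turanSeriesF_first hx.le).sum_add_tsum_nat_add n,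
    ← (summable_turanSeriesF_second hx.le).sum_add_tsum_nat_add n]
  gcongr

theorem lt_turanSeriesF : (1.7215 : ℝ) < turanSeriesF 1.065 := by
  -- The only Taylor estimate is at `1.065 / 2 ^ 9`, where four terms suffice; the remaining
  -- enclosures follow by repeated squaring with outward rounding.
  have e9 : 0.9979220837 ≤ Real.exp (-(1.065 / 2 ^ 9)) ∧ Real.exp (-(1.065 / 2 ^ 9)) ≤ 0.9979220838 := by
    have h := Real.exp_bound (x := -(1.065 / 2 ^ 9)) (by norm_num [abs_of_nonneg]) (n := 4)
      (by norm_num)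
    rw [abs_le] at h
    norm_num [Finset.sum_range_succ, Nat.factorial, abs_of_nonneg] at h ⊢
    constructor <;> linarith [h.1, h.2]
  have e8 : 0.9958484851 ≤ Real.exp (-(1.065 / 2 ^ 8)) ∧ Real.exp (-(1.065 / 2 ^ 8)) ≤ 0.9958484854 :=
    exp_sq_bounds (by convert e9 using 4 <;> ring) (by norm_num) (by norm_num) (by norm_num)
  have e7 : 0.9917142052 ≤ Real.exp (-(1.065 / 2 ^ 7)) ∧ Real.exp (-(1.065 / 2 ^ 7)) ≤ 0.9917142059 :=
    exp_sq_bounds (by convert e8 using 4 <;> ring) (by norm_num) (by norm_num) (by norm_num)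
  have e6 : 0.9834970647 ≤ Real.exp (-(1.065 / 2 ^ 6)) ∧ Real.exp (-(1.065 / 2 ^ 6)) ≤ 0.9834970662 :=
    exp_sq_bounds (by convert e7 using 4 <;> ring) (by norm_num) (by norm_num) (by norm_num)
  have e5 : 0.9672664762 ≤ Real.exp (-(1.065 / 2 ^ 5)) ∧ Real.exp (-(1.065 / 2 ^ 5)) ≤ 0.9672664793 :=
    exp_sq_bounds (by convert e6 using 4 <;> ring) (by norm_num) (by norm_num) (by norm_num)
  have e4 : 0.9356044359 ≤ Real.exp (-(1.065 / 2 ^ 4)) ∧ Real.exp (-(1.065 / 2 ^ 4)) ≤ 0.9356044420 :=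
    exp_sq_bounds (by convert e5 using 4 <;> ring) (by norm_num) (by norm_num) (by norm_num)
  have e3 : 0.8753556604 ≤ Real.exp (-(1.065 / 2 ^ 3)) ∧ Real.exp (-(1.065 / 2 ^ 3)) ≤ 0.8753556719 :=
    exp_sq_bounds (by convert e4 using 4 <;> ring) (by norm_num) (by norm_num) (by norm_num)
  have e2 : 0.7662475321 ≤ Real.exp (-(1.065 / 2 ^ 2)) ∧ Real.exp (-(1.065 / 2 ^ 2)) ≤ 0.7662475524 :=
    exp_sq_bounds (by convert e3 using 4 <;> ring) (by norm_num) (by norm_num) (by norm_num)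
  have e1 : 0.5871352804 ≤ Real.exp (-(1.065 / 2 ^ 1)) ∧ Real.exp (-(1.065 / 2 ^ 1)) ≤ 0.5871353116 :=
    exp_sq_bounds (by convert e2 using 4 <;> ring) (by norm_num) (by norm_num) (by norm_num)
  have e0 : 0.3447278374 ≤ Real.exp (-(1.065 / 2 ^ 0)) ∧ Real.exp (-(1.065 / 2 ^ 0)) ≤ 0.3447278742 :=
    exp_sq_bounds (by convert e1 using 4 <;> ring) (by norm_num) (by norm_num) (by norm_num)
  have hpow : ∀ i : ℕ, (1 / 2 : ℝ) ^ i * 1.065 = 1.065 / 2 ^ i := fun i => by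
    rw [one_div, inv_pow, div_eq_inv_mul]
  refine lt_of_lt_of_le ?_ (le_turanSeriesF (by norm_num) 9)
  simp only [hpow, Finset.sum_range_succ, Finset.sum_range_zero, zero_add, Nat.reduceAdd]
  have e0' := e0
  rw [pow_zero, div_one] at e0'
  -- The function `y / (1 - y ^ 2)` increases on `(0, 1)`, so the lower bound for the exponential is
  -- enough.
  have hfirst : 2 * 1.065 * 0.3447278374 / (1 - 0.3447278374 ^ 2) ≤
      2 * 1.065 * Real.exp (-1.065) / (1 - Real.exp (-1.065) ^ 2) := by
    have h1 : 0 < 1 - Real.exp (-1.065) ^ 2 := by nlinarith [e0'.1, e0'.2]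
    have h2 := e0'.1
    gcongr
  refine lt_of_lt_of_le ?_ (sub_le_sub_right (add_le_add_left hfirst _) _)
  linarith [e0.2, e1.1, e1.2, e2.1, e2.2, e3.1, e3.2, e4.1, e4.2, e5.1, e5.2, e6.1, e6.2, e7.1,
    e7.2, e8.1, e8.2, e9.1, e9.2]

end Numerics

theorem mainTheorem1 :
    -- the limit that defines `π(H_3^r)` exists
    (∀ r : ℕ, 2 ≤ r →
      Tendsto (fun n : ℕ => (RGraph.turanNumber n (RGraph.daisy 3 r) : ℝ) / (n.choose r : ℝ))
        atTop (𝓝 (RGraph.turanDensity (RGraph.daisy 3 r)))) ∧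
    -- `π(H_3^r) ≥ (F(x) - ε - o(1)) / r²` as `r → ∞`
    (∀ x : ℝ, 0 < x → ∀ ε : ℝ, 0 < ε →
      ∃ δ : ℕ → ℝ, Tendsto δ atTop (𝓝 0) ∧
        ∀ r : ℕ, 2 ≤ r →
          (turanSeriesF x - ε - δ r) / (r : ℝ) ^ 2 ≤ RGraph.turanDensity (RGraph.daisy 3 r)) ∧
    -- `F(1.065) > 1.7215`
    (1.7215 : ℝ) < turanSeriesF 1.065 ∧
    -- `π(H_3^r) ≥ (1.7215 - o(1)) r⁻²` as `r → ∞`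
    (∃ δ : ℕ → ℝ, Tendsto δ atTop (𝓝 0) ∧
      ∀ r : ℕ, 2 ≤ r →
        (1.7215 - δ r) / (r : ℝ) ^ 2 ≤ RGraph.turanDensity (RGraph.daisy 3 r)) :=
  ⟨fun r _ => RGraph.tendsto_turanDensity (RGraph.daisy_edges_nonempty 2 r),
    -- The loss `ε` pays for truncating the series at a fixed `N`.
    fun _ hx _ hε => exists_tendsto_zero_le_turanDensity hx (sub_lt_self _ hε),
    lt_turanSeriesF, exists_tendsto_zero_le_turanDensity (by norm_num) lt_turanSeriesF⟩
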